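/- Let $\mathcal N=\omega^\omega$ be the Baire space. For a family $\Gamma$ of pointclasses (a collection $\Gamma(X)$ of subsets of each topological space $X$, closed under preimages by continuous functions) let $\Gamma_c(X)$, $\Gamma_d(X)$, $\Gamma_\sigma(X)$, $\Gamma_\delta(X)$ consist of the complements, differences of two, countable unions and countable intersections of sets in $\Gamma(X)$, and let $\Gamma_\exists(X)=\{\{x\in X\mid \exists p\in\mathcal N.\ (p,x)\in A\}\mid A\in\Gamma(\mathcal N\times X)\}$. The hyperprojective hierarchy is defined, for countable ordinals, by $\mathbf\Sigma^1_0=\mathcal O_{d\sigma}$, where $\mathcal O(X)$ is the class of open sets of $X$, $\mathbf\Sigma^1_{\alpha+1}=(\mathbf\Sigma^1_\alpha)_{c\exists}$, and $\mathbf\Sigma^1_\lambda=(\mathbf\Sigma^1_{<\lambda})_{\delta\exists}$ for limit $\lambda$, where $\mathbf\Sigma^1_{<\lambda}(X)=\bigcup_{\alpha<\lambda}\mathbf\Sigma^1_\alpha(X)$. A qcb$_0$-space is a $T_0$-space that is a topological quotient of a countably based space; $\mathsf{QCB_0}$ is the category of qcb$_0$-spaces and continuous functions. A representation of a space $X$ is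 a surjection $\delta\colon\mathrm{dom}(\delta)\to X$ from a subspace $\mathrm{dom}(\delta)\subseteq\mathcal N$; it is admissible if it is continuous and every continuous $\nu\colon Z\to X$ with $Z\subseteq\mathcal N$ is of the form $\nu=\delta\circ g$ for some continuous $g\colon Z\to\mathrm{dom}(\delta)$. Let $\mathsf{QCB_0}(\Gamma)$ be the class of qcb$_0$-spaces that have an admissible representation $\delta$ with $\{(p,q)\mid p,q\in\mathrm{dom}(\delta),\ \delta(p)=\delta(q)\}\in\Gamma(\mathcal N^2)$. **Proposition.** Let $\lambda$ be a countable limit ordinal. Then $\mathsf{QCB_0}(\mathbf\Sigma^1_{<\lambda})$ is closed under forming co-equalizers in $\mathsf{QCB_0}$. That is, every pair of parallel morphisms in $\mathsf{QCB_0}$ has a co-equalizer in $\mathsf{QCB_0}$, and if $A,X\in\mathsf{QCB_0}(\mathbf\Sigma^1_{<\lambda})$, $f,g\colon A\to X$ are continuous and $q\colon X\to Y$ is a co-equalizer of $f,g$ in $\mathsf{QCB_0}$, then $Y\in\mathsf{QCB_0}(\mathbf\Sigma^1_{<\lambda})$. -/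

import Mathlib

open CategoryTheory CategoryTheory.Limits

universe u

namespace HyperQCB

/-- The Baire space `ω^ω` with the product of the discrete topologies. -/
abbrev Baire : Type := ℕ → ℕ

/-- A family of pointclasses: a collection `Γ(X)` of subsets of `X` for every topological space
`X`, closed under preimages by continuous functions. -/
structure PointclassFamily where
  sets : ∀ (X : Type u) [TopologicalSpace X], Set (Set X)
  preimage_mem : ∀ {X Y : Type u} [TopologicalSpace X] [TopologicalSpace Y] (f : X → Y),
    Continuous f → ∀ A ∈ sets Y, f ⁻¹' A ∈ sets X

namespace PointclassFamily

/-- `Σ⁰₁`: the open sets. -/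
def opens : PointclassFamily.{u} where
  sets _ _ := {A | IsOpen A}
  preimage_mem _ hf _ hA := IsOpen.preimage hf hA

/-- `Γ_d`: differences of two sets in `Γ(X)`. -/
def diff (Γ : PointclassFamily.{u}) : PointclassFamily.{u} where
  sets X _ := {A | ∃ B ∈ Γ.sets X, ∃ C ∈ Γ.sets X, A = B \ C}
  preimage_mem := by
    rintro X Y _ _ f hf _ ⟨B, hB, C, hC, rfl⟩
    exact ⟨_, Γ.preimage_mem f hf B hB, _, Γ.preimage_mem f hf C hC, rfl⟩

/-- `Γ_σ`: countable unions of sets in `Γ(X)`. -/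
def countableUnions (Γ : PointclassFamily.{u}) : PointclassFamily.{u} where
  sets X _ := {A | ∃ B : ℕ → Set X, (∀ n, B n ∈ Γ.sets X) ∧ A = ⋃ n, B n}
  preimage_mem := by
    rintro X Y _ _ f hf _ ⟨B, hB, rfl⟩
    exact ⟨fun n => f ⁻¹' B n, fun n => Γ.preimage_mem f hf _ (hB n), Set.preimage_iUnion⟩

/-- `Γ_δ`: countable intersections of sets in `Γ(X)`. -/
def countableInters (Γ : PointclassFamily.{u}) : PointclassFamily.{u} where
  sets X _ := {A | ∃ B : ℕ → Set X, (∀ n, B n ∈ Γ.sets X) ∧ A = ⋂ n, B n}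
  preimage_mem := by
    rintro X Y _ _ f hf _ ⟨B, hB, rfl⟩
    exact ⟨fun n => f ⁻¹' B n, fun n => Γ.preimage_mem f hf _ (hB n), Set.preimage_iInter⟩

/-- `Γ_c`: complements of sets in `Γ(X)`. -/
def compls (Γ : PointclassFamily.{u}) : PointclassFamily.{u} where
  sets X _ := {A | ∃ B ∈ Γ.sets X, A = Bᶜ}
  preimage_mem := by
    rintro X Y _ _ f hf _ ⟨B, hB, rfl⟩
    exact ⟨_, Γ.preimage_mem f hf B hB, rfl⟩

/-- `Γ_∃`: projections to `X` of the sets in `Γ(𝒩 × X)`, with `𝒩` the Baire space. -/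
def projections (Γ : PointclassFamily.{u}) : PointclassFamily.{u} where
  sets X _ := {A | ∃ B ∈ Γ.sets (Baire × X), A = {x | ∃ p : Baire, (p, x) ∈ B}}
  preimage_mem := by
    rintro X Y _ _ f hf _ ⟨B, hB, rfl⟩
    exact ⟨_, Γ.preimage_mem (fun z : Baire × X => (z.1, f z.2)) (by fun_prop) B hB, rfl⟩

/-- The union of the families `Γ β`, `β < l`. -/
def unionLT (l : Ordinal.{0}) (Γ : ∀ β : Ordinal.{0}, β < l → PointclassFamily.{u}) :
    PointclassFamily.{u} where
  sets X _ := {A | ∃ (β : Ordinal.{0}) (hβ : β < l), A ∈ (Γ β hβ).sets X}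
  preimage_mem := by
    rintro X Y _ _ f hf A ⟨β, hβ, hA⟩
    exact ⟨β, hβ, (Γ β hβ).preimage_mem f hf A hA⟩

end PointclassFamily

/-- The hyperprojective hierarchy `Σ¹_α`, by transfinite recursion:
`Σ¹_0 = Σ⁰_2 = (Σ⁰_1)_{dσ}`, `Σ¹_{α+1} = (Σ¹_α)_{c∃}` and, for limit `l`,
`Σ¹_l = (⋃_{β<l} Σ¹_β)_{δ∃}`. (Only the levels `α < ω₁` are of interest.) -/
noncomputable def sigmaOne (α : Ordinal.{0}) : PointclassFamily.{u} :=
  Ordinal.limitRecOn (motive := fun _ => PointclassFamily.{u}) α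
    PointclassFamily.opens.diff.countableUnions
    (fun _ Γ => Γ.compls.projections)
    (fun l _ Γ => (PointclassFamily.unionLT l Γ).countableInters.projections)

/-- `Σ¹_{<l}`, the union of the `Σ¹_α` with `α < l`. -/
noncomputable def sigmaOneLT (l : Ordinal.{0}) : PointclassFamily.{u} :=
  PointclassFamily.unionLT l (fun α _ => sigmaOne α)

theorem sigmaOne_zero :
    sigmaOne.{u} 0 = PointclassFamily.opens.diff.countableUnions :=
  Ordinal.limitRecOn_zero ..

theorem sigmaOne_succ (α : Ordinal.{0}) :
    sigmaOne.{u} (α + 1) = (sigmaOne α).compls.projections :=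
  Ordinal.limitRecOn_add_one ..

theorem sigmaOne_limit (l : Ordinal.{0}) (hl : Order.IsSuccLimit l) :
    sigmaOne.{u} l = (sigmaOneLT l).countableInters.projections :=
  Ordinal.limitRecOn_limit _ _ _ _ hl

/-- A representation of `X`: a surjection onto `X` from a subspace of the Baire space. -/
structure Representation (X : Type u) where
  dom : Set Baire
  toFun : dom → X
  surjective : Function.Surjective toFun

namespace Representation

variable {X : Type u}

/-- `EQ(δ)`: the pairs of names in the domain of `δ` that name the same point. -/
def EQ (δ : Representation X) : Set (Baire × Baire) :=
  {z | ∃ (hp : z.1 ∈ δ.dom) (hq : z.2 ∈ δ.dom), δ.toFun ⟨z.1, hp⟩ = δ.toFun ⟨z.2, hq⟩}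

/-- A representation `δ` is admissible if it is continuous and every continuous function `ν` to `X`
from a subspace of the Baire space factors as `ν = δ ∘ g` with `g` continuous. -/
def Admissible [TopologicalSpace X] (δ : Representation X) : Prop :=
  Continuous δ.toFun ∧
    ∀ (Z : Set Baire) (ν : Z → X), Continuous ν →
      ∃ g : Z → δ.dom, Continuous g ∧ ν = δ.toFun ∘ g

end Representation

/-- A qcb₀-space: a `T₀`-space that is a topological quotient of a countably based space. -/
def IsQCB0 : ObjectProperty TopCat.{u} := fun X =>
  T0Space X ∧ ∃ (Z : Type u) (_ : TopologicalSpace Z) (π : Z → X),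
    SecondCountableTopology Z ∧ Topology.IsQuotientMap π

/-- The category of qcb₀-spaces and continuous functions. -/
abbrev QCB0 : Type (u + 1) := (IsQCB0.{u}).FullSubcategory

/-- The class `QCB₀(Γ)` of the qcb₀-spaces that have an admissible representation `δ` with
`EQ(δ) ∈ Γ(𝒩²)`. -/
def QCB0Of (Γ : PointclassFamily.{0}) : ObjectProperty QCB0.{u} := fun X =>
  ∃ δ : Representation X.obj, δ.Admissible ∧ δ.EQ ∈ Γ.sets (Baire × Baire)

end HyperQCB

/-! The coequalizer is the universal T₀ quotient of `X` in which `f a` and `g a` agree: two points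
are identified when no open `U` with `f⁻¹ U = g⁻¹ U` separates them. An admissible representation of
`X` is a quotient map (`Representation.Admissible.isQuotientMap`), so `Y` becomes a quotient `ρ : D
→ Y` of a subspace of Baire space.

Such a `ρ` need not be admissible. It is replaced by the representation in which a name of `y` lists
saturated images of finite unions of basic open sets, all containing `y` and forming a network at
`y`. Its admissibility rests on `exists_satBasic_seq`: an open set contains a sequence of such
images that catches every sequence converging into it.

For the complexity, `Σ¹_{<l}` with `l` a limit is closed under Boolean operations and under
quantifiers over Baire space, so any formula built from definable parts is definable. Open subsets
of `Y` are coded by sequences. `IsT0Coequalizer.codesOpen_iff` expresses coding through `EQ` of `X`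
and realizers of `f` and `g`, and `isName_iff_codesOpen` expresses naming through coding. -/

namespace HyperQCB

/-! ### Closure properties of the hyperprojective hierarchy -/

namespace PointclassFamily

/-- Inclusion of families of pointclasses. -/
def Sub (Γ Δ : PointclassFamily.{u}) : Prop :=
  ∀ (X : Type u) [TopologicalSpace X], Γ.sets X ⊆ Δ.sets X

/-- The pointclasses of the family are closed under binary unions and intersections. -/
structure IsLattice (Γ : PointclassFamily.{u}) : Prop where
  union : ∀ {X : Type u} [TopologicalSpace X] {A B : Set X},
    A ∈ Γ.sets X → B ∈ Γ.sets X → A ∪ B ∈ Γ.sets X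
  inter : ∀ {X : Type u} [TopologicalSpace X] {A B : Set X},
    A ∈ Γ.sets X → B ∈ Γ.sets X → A ∩ B ∈ Γ.sets X

theorem Sub.compls_projections {Γ Δ : PointclassFamily.{u}} (h : Γ.Sub Δ) :
    Γ.compls.projections.Sub Δ.compls.projections := by
  rintro X _ _ ⟨_, ⟨B, hB, rfl⟩, rfl⟩
  exact ⟨_, ⟨B, h _ hB, rfl⟩, rfl⟩

theorem sub_projections (Γ : PointclassFamily.{u}) : Γ.Sub Γ.projections := by
  intro X _ A hA
  exact ⟨_, Γ.preimage_mem Prod.snd continuous_snd A hA, by ext; simp⟩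

theorem sub_countableInters (Γ : PointclassFamily.{u}) : Γ.Sub Γ.countableInters := by
  intro X _ A hA
  exact ⟨fun _ => A, fun _ => hA, (Set.iInter_const A).symm⟩

/-- The even part of a sequence. -/
def evenPart (p : Baire) : Baire := fun n => p (2 * n)

/-- The odd part of a sequence. -/
def oddPart (p : Baire) : Baire := fun n => p (2 * n + 1)

theorem continuous_evenPart : Continuous evenPart := by unfold evenPart; fun_prop

theorem continuous_oddPart : Continuous oddPart := by unfold oddPart; fun_prop

theorem exists_evenPart_oddPart (p q : Baire) : ∃ r, evenPart r = p ∧ oddPart r = q := by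
  refine ⟨fun n => if n % 2 = 0 then p (n / 2) else q (n / 2), ?_, ?_⟩
  · funext n; simp [evenPart]
  · funext n
    have h1 : (2 * n + 1) % 2 = 1 := by omega
    have h2 : (2 * n + 1) / 2 = n := by omega
    simp [oddPart, h1, h2]

/-- Two witnesses in Baire space merge into one sequence, as its even and odd parts. -/
theorem projections_inter {Γ : PointclassFamily.{u}}
    (h : ∀ {X : Type u} [TopologicalSpace X] {A B : Set X},
      A ∈ Γ.sets X → B ∈ Γ.sets X → A ∩ B ∈ Γ.sets X)
    {X : Type u} [TopologicalSpace X] {A B : Set X}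
    (hA : A ∈ Γ.projections.sets X) (hB : B ∈ Γ.projections.sets X) :
    A ∩ B ∈ Γ.projections.sets X := by
  obtain ⟨E, hE, rfl⟩ := hA
  obtain ⟨F, hF, rfl⟩ := hB
  refine ⟨_, h (Γ.preimage_mem (fun z : Baire × X => (evenPart z.1, z.2))
      (by have := continuous_evenPart; fun_prop) E hE)
    (Γ.preimage_mem (fun z : Baire × X => (oddPart z.1, z.2))
      (by have := continuous_oddPart; fun_prop) F hF), ?_⟩
  ext x
  constructor
  · rintro ⟨⟨p, hp⟩, q, hq⟩
    obtain ⟨r, rfl, rfl⟩ := exists_evenPart_oddPart p q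
    exact ⟨r, hp, hq⟩
  · rintro ⟨r, hp, hq⟩
    exact ⟨⟨_, hp⟩, _, hq⟩

theorem projections_union {Γ : PointclassFamily.{u}}
    (h : ∀ {X : Type u} [TopologicalSpace X] {A B : Set X},
      A ∈ Γ.sets X → B ∈ Γ.sets X → A ∪ B ∈ Γ.sets X)
    {X : Type u} [TopologicalSpace X] {A B : Set X}
    (hA : A ∈ Γ.projections.sets X) (hB : B ∈ Γ.projections.sets X) :
    A ∪ B ∈ Γ.projections.sets X := by
  obtain ⟨E, hE, rfl⟩ := hA
  obtain ⟨F, hF, rfl⟩ := hB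
  exact ⟨_, h hE hF, by ext x; simp [exists_or]⟩

theorem IsLattice.projections {Γ : PointclassFamily.{u}} (h : Γ.IsLattice) :
    Γ.projections.IsLattice :=
  ⟨projections_union h.union, projections_inter h.inter⟩

theorem IsLattice.compls {Γ : PointclassFamily.{u}} (h : Γ.IsLattice) : Γ.compls.IsLattice where
  union := by
    rintro X _ _ _ ⟨E, hE, rfl⟩ ⟨F, hF, rfl⟩
    exact ⟨_, h.inter hE hF, (Set.compl_inter _ _).symm⟩
  inter := by
    rintro X _ _ _ ⟨E, hE, rfl⟩ ⟨F, hF, rfl⟩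
    exact ⟨_, h.union hE hF, (Set.compl_union _ _).symm⟩

theorem IsLattice.countableInters {Γ : PointclassFamily.{u}} (h : Γ.IsLattice) :
    Γ.countableInters.IsLattice where
  union := by
    rintro X _ _ _ ⟨E, hE, rfl⟩ ⟨F, hF, rfl⟩
    refine ⟨fun n => E n.unpair.1 ∪ F n.unpair.2, fun n => h.union (hE _) (hF _), ?_⟩
    ext x
    simp only [Set.mem_union, Set.mem_iInter]
    constructor
    · rintro (hx | hx) n
      · exact Or.inl (hx _)
      · exact Or.inr (hx _)
    · intro hx
      by_contra! hc
      obtain ⟨⟨i, hi⟩, j, hj⟩ := hc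
      have := hx (Nat.pair i j)
      simp [hi, hj] at this
  inter := by
    rintro X _ _ _ ⟨E, hE, rfl⟩ ⟨F, hF, rfl⟩
    exact ⟨fun n => E n ∩ F n, fun n => h.inter (hE n) (hF n), (Set.iInter_inter_distrib _ _).symm⟩

theorem isLattice_opens_diff_countableUnions :
    (opens.{u}.diff.countableUnions).IsLattice where
  union := by
    rintro X _ _ _ ⟨E, hE, rfl⟩ ⟨F, hF, rfl⟩
    refine ⟨fun n => if n % 2 = 0 then E (n / 2) else F (n / 2), fun n => ?_, ?_⟩
    · dsimp only; split_ifs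
      exacts [hE _, hF _]
    · ext x
      simp only [Set.mem_union, Set.mem_iUnion]
      constructor
      · rintro (⟨i, hi⟩ | ⟨i, hi⟩)
        · exact ⟨2 * i, by simpa using hi⟩
        · refine ⟨2 * i + 1, ?_⟩
          have h1 : (2 * i + 1) % 2 = 1 := by omega
          have h2 : (2 * i + 1) / 2 = i := by omega
          simpa [h1, h2] using hi
      · rintro ⟨n, hn⟩
        split_ifs at hn
        exacts [Or.inl ⟨_, hn⟩, Or.inr ⟨_, hn⟩]
  inter := by
    rintro X _ _ _ ⟨E, hE, rfl⟩ ⟨F, hF, rfl⟩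
    refine ⟨fun n => E n.unpair.1 ∩ F n.unpair.2, fun n => ?_, ?_⟩
    · obtain ⟨B, hB, C, hC, h1⟩ := hE n.unpair.1
      obtain ⟨B', hB', C', hC', h2⟩ := hF n.unpair.2
      refine ⟨B ∩ B', IsOpen.inter hB hB', C ∪ C', IsOpen.union hC hC', ?_⟩
      dsimp only
      rw [h1, h2]
      ext x
      simp only [Set.mem_inter_iff, Set.mem_sdiff, Set.mem_union]
      tauto
    · ext x
      simp only [Set.mem_inter_iff, Set.mem_iUnion]
      constructor
      · rintro ⟨⟨i, hi⟩, j, hj⟩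
        exact ⟨Nat.pair i j, by simpa using ⟨hi, hj⟩⟩
      · rintro ⟨n, h1, h2⟩
        exact ⟨⟨_, h1⟩, _, h2⟩

theorem mem_opens {X : Type u} [TopologicalSpace X] {A : Set X} (hA : IsOpen A) :
    A ∈ opens.sets X := hA

theorem opens_sub_opens_diff_countableUnions : opens.{u}.Sub opens.diff.countableUnions := by
  intro X _ A hA
  exact ⟨fun _ => A, fun _ => ⟨A, hA, ∅, isOpen_empty, Set.sdiff_empty.symm⟩, (Set.iUnion_const A).symm⟩

end PointclassFamily

open PointclassFamily

theorem isOpen_setOf_prod_nat {X Y : Type*} [TopologicalSpace X] [TopologicalSpace Y]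
    {f : X → ℕ} (hf : Continuous f) {g : X → Y} (hg : Continuous g) {B : ℕ → Set Y}
    (hB : ∀ n, IsOpen (B n)) : IsOpen {x | g x ∈ B (f x)} := by
  have : {x | g x ∈ B (f x)} = ⋃ n, f ⁻¹' {n} ∩ g ⁻¹' B n := by
    ext x; simp
  rw [this]
  exact isOpen_iUnion fun n => ((isOpen_discrete _).preimage hf).inter ((hB n).preimage hg)

/-- The index of the union is guessed as `p 0`. What remains is a difference of two open sets, whose
complement is again `Σ⁰₂`. -/
theorem sigmaOne_zero_sub_one :
    (opens.{u}.diff.countableUnions).Sub opens.diff.countableUnions.compls.projections := by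
  rintro X _ _ ⟨E, hE, rfl⟩
  choose B hB C hC h using hE
  have hf : Continuous fun z : Baire × X => z.1 0 := by fun_prop
  refine ⟨_, ⟨(Set.univ \ {z : Baire × X | z.2 ∈ B (z.1 0)}) ∪ {z : Baire × X | z.2 ∈ C (z.1 0)},
    isLattice_opens_diff_countableUnions.union ?_ ?_, rfl⟩, ?_⟩
  · exact ⟨fun _ => _, fun _ => ⟨Set.univ, mem_opens isOpen_univ, _,
      isOpen_setOf_prod_nat hf continuous_snd hB, rfl⟩, (Set.iUnion_const _).symm⟩
  · exact opens_sub_opens_diff_countableUnions _ (isOpen_setOf_prod_nat hf continuous_snd hC)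
  · ext x
    simp only [h, Set.mem_iUnion, Set.mem_sdiff, Set.mem_ofPred_eq, Set.mem_compl_iff,
      Set.mem_union, Set.mem_univ, true_and, not_or, not_not]
    constructor
    · rintro ⟨n, hn⟩
      exact ⟨fun _ => n, hn⟩
    · rintro ⟨p, hp⟩
      exact ⟨_, hp⟩

/-- The closure properties of a level of the hierarchy relative to the other levels. -/
structure IsGoodLevel (α : Ordinal.{0}) : Prop where
  sub : ∀ β ≤ α, (sigmaOne.{u} β).Sub (sigmaOne α)
  sub_succ : (sigmaOne.{u} α).Sub (sigmaOne (α + 1))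
  lattice : (sigmaOne.{u} α).IsLattice

section Limit

variable {l : Ordinal.{0}}

theorem isOpen_mem_sigmaOneLT (hl : Order.IsSuccLimit l) {X : Type u} [TopologicalSpace X]
    {A : Set X} (hA : IsOpen A) : A ∈ (sigmaOneLT.{u} l).sets X := by
  refine ⟨0, hl.bot_lt, ?_⟩
  beta_reduce
  rw [sigmaOne_zero]
  exact opens_sub_opens_diff_countableUnions _ hA

theorem compl_mem_sigmaOneLT (hl : Order.IsSuccLimit l) {X : Type u} [TopologicalSpace X]
    {A : Set X} (hA : A ∈ (sigmaOneLT.{u} l).sets X) : Aᶜ ∈ (sigmaOneLT.{u} l).sets X := by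
  obtain ⟨α, hα, hA⟩ := hA
  refine ⟨α + 1, hl.add_one_lt hα, ?_⟩
  beta_reduce
  rw [sigmaOne_succ]
  exact sub_projections _ _ ⟨A, hA, rfl⟩

/-- A successor step projects complements, so it is applied to the complement of `A`, which also
lies below `l`. -/
theorem projection_mem_sigmaOneLT (hl : Order.IsSuccLimit l) {X : Type u} [TopologicalSpace X]
    {A : Set (Baire × X)} (hA : A ∈ (sigmaOneLT.{u} l).sets (Baire × X)) :
    {x | ∃ p, (p, x) ∈ A} ∈ (sigmaOneLT.{u} l).sets X := by
  obtain ⟨α, hα, hA⟩ := compl_mem_sigmaOneLT hl hA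
  refine ⟨α + 1, hl.add_one_lt hα, ?_⟩
  beta_reduce
  rw [sigmaOne_succ]
  exact ⟨_, ⟨_, hA, rfl⟩, by simp⟩

theorem isLattice_sigmaOneLT (h : ∀ α < l, IsGoodLevel.{u} α) : (sigmaOneLT.{u} l).IsLattice where
  union := by
    rintro X _ A B ⟨α, hα, hA⟩ ⟨β, hβ, hB⟩
    have hm : max α β < l := max_lt hα hβ
    exact ⟨_, hm, (h _ hm).lattice.union ((h _ hm).sub _ (le_max_left _ _) _ hA)
      ((h _ hm).sub _ (le_max_right _ _) _ hB)⟩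
  inter := by
    rintro X _ A B ⟨α, hα, hA⟩ ⟨β, hβ, hB⟩
    have hm : max α β < l := max_lt hα hβ
    exact ⟨_, hm, (h _ hm).lattice.inter ((h _ hm).sub _ (le_max_left _ _) _ hA)
      ((h _ hm).sub _ (le_max_right _ _) _ hB)⟩

/-- It suffices that the complement of `⋂ B n` is in `Σ¹_l`. A point lies in it when some `p`
satisfies, for all `n`, `p 0 ≠ n` or membership in `(B n)ᶜ`: the union over `n` becomes a projection
of a countable intersection. -/
theorem sigmaOne_limit_sub_succ (hl : Order.IsSuccLimit l)
    (h : (sigmaOneLT.{u} l).IsLattice) : (sigmaOne.{u} l).Sub (sigmaOne (l + 1)) := by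
  rw [sigmaOne_succ, sigmaOne_limit l hl]
  rintro X _ _ ⟨_, ⟨B, hB, rfl⟩, rfl⟩
  refine ⟨⋂ n, B n, ⟨⋃ n, (B n)ᶜ, ⟨_, ⟨fun n => {z : Baire × Baire × X | z.1 0 ≠ n} ∪
    Prod.snd ⁻¹' (B n)ᶜ, fun n => h.union (isOpen_mem_sigmaOneLT hl ?_)
    (PointclassFamily.preimage_mem _ _ continuous_snd _ (compl_mem_sigmaOneLT hl (hB n))),
    rfl⟩, ?_⟩, by simp⟩, rfl⟩
  · exact (isOpen_discrete {m : ℕ | m ≠ n}).preimage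
      (by fun_prop : Continuous fun z : Baire × Baire × X => z.1 0)
  · ext z
    simp only [Set.mem_iUnion, Set.mem_compl_iff, Set.mem_iInter, Set.mem_union, Set.mem_ofPred_eq,
      Set.mem_preimage]
    constructor
    · rintro ⟨n, hn⟩
      refine ⟨fun _ => n, fun m => ?_⟩
      by_cases hm : n = m
      · exact Or.inr (hm ▸ hn)
      · exact Or.inl hm
    · rintro ⟨p, hp⟩
      exact ⟨p 0, (hp (p 0)).resolve_left (by simp)⟩

end Limit

/-- The properties are proved together because passing from a limit to its successor uses the
lattice property below the limit, which in turn uses monotonicity. -/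
theorem isGoodLevel (α : Ordinal.{0}) : IsGoodLevel.{u} α := by
  induction α using Ordinal.limitRecOn with
  | zero =>
    refine ⟨fun β hβ => ?_, ?_, ?_⟩
    · obtain rfl : β = 0 := by simpa using hβ
      exact fun _ _ _ h => h
    · rw [sigmaOne_succ, sigmaOne_zero]
      exact sigmaOne_zero_sub_one
    · rw [sigmaOne_zero]
      exact isLattice_opens_diff_countableUnions
  | add_one α ih =>
    refine ⟨fun β hβ => ?_, ?_, ?_⟩
    · rcases hβ.eq_or_lt with rfl | hβ
      · exact fun _ _ _ h => h
      · exact fun _ _ _ h => ih.sub_succ _ (ih.sub β (Order.lt_add_one_iff.mp hβ) _ h)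
    · rw [sigmaOne_succ (α + 1)]
      nth_rewrite 1 [sigmaOne_succ]
      exact ih.sub_succ.compls_projections
    · rw [sigmaOne_succ]
      exact ih.lattice.compls.projections
  | limit l hl ih =>
    have hlat := isLattice_sigmaOneLT ih
    refine ⟨fun β hβ => ?_, sigmaOne_limit_sub_succ hl hlat, ?_⟩
    · rcases hβ.eq_or_lt with rfl | hβ
      · exact fun _ _ _ h => h
      · rw [sigmaOne_limit l hl]
        exact fun _ _ _ h => sub_projections _ _ (sub_countableInters _ _ ⟨β, hβ, h⟩)
    · rw [sigmaOne_limit l hl]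
      exact hlat.countableInters.projections

/-! ### Definable predicates and quantifiers -/

/-- The predicate `P` on `X` defines a set in `Σ¹_{<l}(X)`. -/
def Definable (l : Ordinal.{0}) {X : Type} [TopologicalSpace X] (P : X → Prop) : Prop :=
  {x | P x} ∈ (sigmaOneLT.{0} l).sets X

namespace Definable

variable {l : Ordinal.{0}} {X Y : Type} [TopologicalSpace X] [TopologicalSpace Y]

theorem comp {P : Y → Prop} (h : Definable l P) {f : X → Y} (hf : Continuous f) :
    Definable l fun x => P (f x) :=
  PointclassFamily.preimage_mem _ f hf _ h

theorem of_isOpen (hl : Order.IsSuccLimit l) {P : X → Prop} (h : IsOpen {x | P x}) :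
    Definable l P :=
  isOpen_mem_sigmaOneLT hl h

protected theorem and {P Q : X → Prop} (hP : Definable l P) (hQ : Definable l Q) :
    Definable l fun x => P x ∧ Q x :=
  (isLattice_sigmaOneLT fun _ _ => isGoodLevel _).inter hP hQ

protected theorem not (hl : Order.IsSuccLimit l) {P : X → Prop} (hP : Definable l P) :
    Definable l fun x => ¬ P x :=
  compl_mem_sigmaOneLT hl hP

theorem congr {P Q : X → Prop} (hP : Definable l P) (h : ∀ x, Q x ↔ P x) : Definable l Q := by
  obtain rfl : Q = P := funext fun x => propext (h x)
  exact hP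

protected theorem imp (hl : Order.IsSuccLimit l) {P Q : X → Prop} (hP : Definable l P)
    (hQ : Definable l Q) : Definable l fun x => P x → Q x :=
  ((hP.and (hQ.not hl)).not hl).congr fun x => by tauto

theorem exists_baire (hl : Order.IsSuccLimit l) {P : X → Baire → Prop}
    (hP : Definable l fun z : Baire × X => P z.2 z.1) : Definable l fun x => ∃ p, P x p :=
  projection_mem_sigmaOneLT hl hP

theorem forall_baire (hl : Order.IsSuccLimit l) {P : X → Baire → Prop}
    (hP : Definable l fun z : Baire × X => P z.2 z.1) : Definable l fun x => ∀ p, P x p :=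
  ((exists_baire hl (P := fun x p => ¬ P x p) (hP.not hl)).not hl).congr fun x => by simp

theorem exists_nat (hl : Order.IsSuccLimit l) {P : X → ℕ → Prop}
    (hP : Definable l fun z : ℕ × X => P z.2 z.1) : Definable l fun x => ∃ n, P x n := by
  have := hP.comp (f := fun z : Baire × X => (z.1 0, z.2)) (by fun_prop)
  exact (exists_baire hl (P := fun x p => P x (p 0)) this).congr fun x =>
    ⟨fun ⟨n, hn⟩ => ⟨fun _ => n, hn⟩, fun ⟨p, hp⟩ => ⟨_, hp⟩⟩

theorem forall_nat (hl : Order.IsSuccLimit l) {P : X → ℕ → Prop}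
    (hP : Definable l fun z : ℕ × X => P z.2 z.1) : Definable l fun x => ∀ n, P x n :=
  ((exists_nat hl (P := fun x n => ¬ P x n) (hP.not hl)).not hl).congr fun x => by simp

end Definable

/-! ### Names for the points of a quotient of a subspace of Baire space -/

open Topology Filter

theorem eventually_agree (p : Baire) (m : ℕ) : ∀ᶠ q in 𝓝 p, ∀ i < m, q i = p i := by
  have : ∀ᶠ q in 𝓝 p, ∀ i ∈ Finset.range m, q i = p i := by
    rw [Filter.eventually_all_finset]
    intro i _
    have h : Continuous fun q : Baire => q i := continuous_apply i
    exact ((isOpen_discrete {p i}).preimage h).mem_nhds rfl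
  simpa using this

/-- A sequence of open sets of Baire space, with the whole space among them, such that every open
set is the union of a sequence of its members. -/
structure OpenEnumeration where
  basic : ℕ → Set Baire
  isOpen_basic : ∀ n, IsOpen (basic n)
  exists_univ : ∃ n, basic n = Set.univ
  exists_iUnion : ∀ O : Set Baire, IsOpen O → ∃ c : Baire, ⋃ i, basic (c i) = O

theorem nonempty_openEnumeration : Nonempty OpenEnumeration := by
  let B := TopologicalSpace.countableBasis Baire
  have hB := TopologicalSpace.isBasis_countableBasis Baire
  -- The empty set is included so that every open `O`, even `∅`, contains some member and the
  -- indices of its members can be listed by a sequence.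
  let S : Set (Set Baire) := insert ∅ (insert Set.univ B)
  have hS : S.Countable :=
    ((TopologicalSpace.countable_countableBasis Baire).insert _).insert _
  obtain ⟨b, hb⟩ := hS.exists_eq_range ⟨∅, Set.mem_insert _ _⟩
  have hmem : ∀ s ∈ S, ∃ n, b n = s := fun s hs => by rwa [hb] at hs
  have hopen : ∀ n, IsOpen (b n) := by
    intro n
    have : b n ∈ S := hb ▸ Set.mem_range_self n
    rcases this with h | h | h
    · rw [h]; exact isOpen_empty
    · rw [h]; exact isOpen_univ
    · exact hB.isOpen h
  refine ⟨⟨b, hopen, hmem _ (Or.inr (Or.inl rfl)), fun O hO => ?_⟩⟩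
  have hT : ({n | b n ⊆ O}).Countable := Set.to_countable _
  obtain ⟨e, he⟩ := hmem ∅ (Or.inl rfl)
  obtain ⟨c, hc⟩ := hT.exists_eq_range ⟨e, by simp [he]⟩
  refine ⟨c, Set.Subset.antisymm (Set.iUnion_subset fun i => ?_) fun x hx => ?_⟩
  · have : c i ∈ {n | b n ⊆ O} := hc ▸ Set.mem_range_self i
    exact this
  · obtain ⟨v, hv, hxv, hvO⟩ := hB.exists_subset_of_mem_open hx hO
    obtain ⟨n, hn⟩ := hmem v (Or.inr (Or.inr hv))
    have : n ∈ Set.range c := hc ▸ (show b n ⊆ O from hn ▸ hvO)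
    obtain ⟨i, rfl⟩ := this
    exact Set.mem_iUnion.mpr ⟨i, hn ▸ hxv⟩

namespace OpenEnumeration

variable (b : OpenEnumeration)

/-- The open set coded by `c`. -/
def opn (c : Baire) : Set Baire := ⋃ i, b.basic (c i)

theorem mem_opn {c x : Baire} : x ∈ b.opn c ↔ ∃ i, x ∈ b.basic (c i) := Set.mem_iUnion

theorem isOpen_opn (c : Baire) : IsOpen (b.opn c) := isOpen_iUnion fun _ => b.isOpen_basic _

theorem isOpen_mem_basic : IsOpen {z : ℕ × Baire | z.2 ∈ b.basic z.1} :=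
  isOpen_setOf_prod_nat continuous_fst continuous_snd b.isOpen_basic

theorem isOpen_mem_opn : IsOpen {z : Baire × Baire | z.2 ∈ b.opn z.1} := by
  have : {z : Baire × Baire | z.2 ∈ b.opn z.1} = ⋃ i, {z | z.2 ∈ b.basic (z.1 i)} := by
    ext z; simp [mem_opn]
  rw [this]
  exact isOpen_iUnion fun i =>
    isOpen_setOf_prod_nat (by fun_prop) continuous_snd b.isOpen_basic

variable {D : Set Baire} {Y : Type u} [TopologicalSpace Y] (ρ : D → Y)

/-- The saturation of the image of the union of the basic sets with indices in the `k`-th list. -/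
def satBasic (k : ℕ) : Set Y :=
  {y | ∃ n ∈ Denumerable.ofNat (List ℕ) k, ∃ x : D, x.1 ∈ b.basic n ∧ y ⤳ ρ x}

/-- `p` enumerates saturated images of basic sets that contain `y` and form a
neighbourhood network at `y`. -/
def IsName (p : Baire) (y : Y) : Prop :=
  (∀ i, y ∈ b.satBasic ρ (p i)) ∧
    ∀ U : Set Y, IsOpen U → y ∈ U → ∃ i, b.satBasic ρ (p i) ⊆ U

/-- `c` codes the preimage of an open set of `Y`. -/
def CodesOpen (c : Baire) : Prop :=
  ∃ V : Set Y, IsOpen V ∧ ∀ x : D, ρ x ∈ V ↔ x.1 ∈ b.opn c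

variable {ρ}

theorem exists_opn_eq (hρ : Continuous ρ) {V : Set Y} (hV : IsOpen V) :
    ∃ c, ∀ x : D, ρ x ∈ V ↔ x.1 ∈ b.opn c := by
  obtain ⟨O, hO, h⟩ := isOpen_induced_iff.mp (hV.preimage hρ)
  obtain ⟨c, hc⟩ := b.exists_iUnion O hO
  refine ⟨c, fun x => ?_⟩
  rw [opn, hc]
  exact (Set.ext_iff.mp h x).symm

/-- Open sets are stable under generalization, so saturating an image does not affect which open
sets contain it. -/
theorem satBasic_subset_iff {k : ℕ} {U : Set Y} (hU : IsOpen U) :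
    b.satBasic ρ k ⊆ U ↔ ∀ n ∈ Denumerable.ofNat (List ℕ) k, ∀ x : D, x.1 ∈ b.basic n →
      ρ x ∈ U := by
  constructor
  · intro h n hn x hx
    exact h ⟨n, hn, x, hx, specializes_rfl⟩
  · rintro h y ⟨n, hn, x, hx, hy⟩
    exact hy.mem_open hU (h n hn x hx)

theorem IsName.unique [T0Space Y] {p : Baire} {y z : Y} (hy : b.IsName ρ p y)
    (hz : b.IsName ρ p z) : y = z := by
  refine (inseparable_iff_forall_isOpen.mpr fun U hU => ⟨fun h => ?_, fun h => ?_⟩).eq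
  · obtain ⟨i, hi⟩ := hy.2 U hU h
    exact hi (hz.1 i)
  · obtain ⟨i, hi⟩ := hz.2 U hU h
    exact hi (hy.1 i)

/-- Every open set contains a sequence of saturated images of finite unions of basic sets which
meets every sequence that converges in the open set. -/
theorem exists_satBasic_seq (hρ : IsQuotientMap ρ) {U : Set Y} (hU : IsOpen U) :
    ∃ k : ℕ → ℕ, (∀ i, b.satBasic ρ (k i) ⊆ U) ∧
      ∀ (y : ℕ → Y) (z : Y), Tendsto y atTop (𝓝 z) → z ∈ U → ∃ i, y i ∈ b.satBasic ρ (k i) := by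
  obtain ⟨c, hc⟩ := b.exists_opn_eq hρ.continuous hU
  -- The `i`-th list is `c 0, …, c i`, so the sets increase with `i`.
  let k : ℕ → ℕ := fun i => Encodable.encode ((List.range (i + 1)).map c)
  have hk : ∀ i n, n ∈ Denumerable.ofNat (List ℕ) (k i) ↔ ∃ j ≤ i, c j = n := by
    intro i n
    simp [k]
  refine ⟨k, fun i => ?_, fun y z hyz hz => ?_⟩
  · rw [b.satBasic_subset_iff hU]
    intro n hn x hx
    obtain ⟨j, -, rfl⟩ := (hk _ _).mp hn
    exact (hc x).mpr (b.mem_opn.mpr ⟨j, hx⟩)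
  by_contra! hy
  obtain ⟨x, rfl⟩ := hρ.surjective z
  obtain ⟨j, hj⟩ := b.mem_opn.mp ((hc x).mp hz)
  have key : ∀ (x : D) (m i : ℕ), x.1 ∈ b.basic (c m) → m ≤ i → ¬ y i ⤳ ρ x :=
    fun x m i hx hmi hs => hy i ⟨c m, (hk _ _).mpr ⟨m, hmi, rfl⟩, x, hx, hs⟩
  -- `Y` need not be T₁, so closures of the points `y i` are removed from `U` rather than the
  -- points. On `basic (c m)` only the indices `i < m` impose a condition, by `key`, which makes `V`
  -- open. It is a neighbourhood of the limit, yet contains no `y i` with `i ≥ j`.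
  let V : Set Y := {w | w ∈ U ∧ ∀ i, j ≤ i → ¬ y i ⤳ w}
  have hV : IsOpen V := by
    rw [← hρ.isOpen_preimage]
    have : ρ ⁻¹' V = ⋃ m, (Subtype.val ⁻¹' b.basic (c m)) ∩
        ⋂ i ∈ Finset.range m, {x | j ≤ i → ¬ y i ⤳ ρ x} := by
      ext x
      simp only [V, Set.mem_preimage, Set.mem_ofPred_eq, Set.mem_iUnion, Set.mem_inter_iff,
        Set.mem_iInter, Finset.mem_range]
      constructor
      · rintro ⟨hx, h⟩
        obtain ⟨m, hm⟩ := b.mem_opn.mp ((hc x).mp hx)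
        exact ⟨m, hm, fun i _ => h i⟩
      · rintro ⟨m, hm, h⟩
        refine ⟨(hc x).mpr (b.mem_opn.mpr ⟨m, hm⟩), fun i hi => ?_⟩
        rcases lt_or_ge i m with him | him
        · exact h i him hi
        · exact key x m i hm him
    rw [this]
    refine isOpen_iUnion fun m => ((b.isOpen_basic _).preimage continuous_subtype_val).inter
      (isOpen_biInter_finset fun i _ => ?_)
    by_cases hi : j ≤ i
    · have : {x | j ≤ i → ¬ y i ⤳ ρ x} = ρ ⁻¹' (closure {y i})ᶜ := by
        ext x; simp [hi, specializes_iff_mem_closure]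
      rw [this]
      exact isClosed_closure.isOpen_compl.preimage hρ.continuous
    · simp [hi]
  have hxV : ρ x ∈ V := ⟨hz, fun i hi => key x j i hj hi⟩
  obtain ⟨i, hi, hij⟩ := ((hyz.eventually (hV.mem_nhds hxV)).and (eventually_ge_atTop j)).exists
  exact hi.2 i hij specializes_rfl

/-- A continuous function from a subspace of Baire space to `Y` has a continuous choice of names of
its values. -/
theorem exists_continuous_isName (hρ : IsQuotientMap ρ) (Z : Set Baire) (ν : Z → Y)
    (hν : Continuous ν) : ∃ g : Z → Baire, Continuous g ∧ ∀ z, b.IsName ρ (g z) (ν z) := by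
  classical
  obtain ⟨v, hv⟩ := b.exists_univ
  let e : ℕ := Encodable.encode [v]
  -- The code `e` denotes all of `Y`, hence is a harmless default entry of any name.
  have he : ∀ y, y ∈ b.satBasic ρ e := by
    intro y
    obtain ⟨x, rfl⟩ := hρ.surjective y
    exact ⟨v, by simp [e], x, by simp [hv], specializes_rfl⟩
  let restr : ∀ m : ℕ, Z → Fin m → ℕ := fun m z j => z.1 j
  -- The entry for `(m, k)` is `k` if the whole cylinder given by the first `m` values maps into the
  -- `k`-th set. It depends on finitely many values, which gives continuity.
  let G : ∀ m k : ℕ, (Fin m → ℕ) → ℕ := fun m k r =>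
    if ∀ z, restr m z = r → ν z ∈ b.satBasic ρ k then k else e
  refine ⟨fun z i => G i.unpair.1 i.unpair.2 (restr i.unpair.1 z), ?_, fun z => ⟨fun i => ?_,
    fun U hU hz => ?_⟩⟩
  · refine continuous_pi fun i => (continuous_of_discreteTopology (f := G _ _)).comp ?_
    exact continuous_pi fun j => (continuous_apply _).comp continuous_subtype_val
  · dsimp only [G]
    split_ifs with h
    · exact h z rfl
    · exact he _
  · obtain ⟨k, hkU, hk⟩ := b.exists_satBasic_seq hρ hU
    -- Otherwise points agreeing with `z` on longer and longer prefixes converge to `z`, while their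
    -- images miss every `k m`-th set.
    have : ∃ m, ∀ z', restr m z' = restr m z → ν z' ∈ b.satBasic ρ (k m) := by
      by_contra! hcon
      choose z' hz' hz'k using hcon
      have hlim : Tendsto z' atTop (𝓝 z) := by
        rw [tendsto_subtype_rng, tendsto_pi_nhds]
        intro i
        refine tendsto_nhds_of_eventually_eq ?_
        filter_upwards [eventually_gt_atTop i] with m hm
        exact congrFun (hz' m) ⟨i, hm⟩
      obtain ⟨i, hi⟩ := hk (fun m => ν (z' m)) (ν z) ((hν.tendsto z).comp hlim) hz
      exact hz'k i hi
    obtain ⟨m, hm⟩ := this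
    refine ⟨Nat.pair m (k m), ?_⟩
    have : G (Nat.pair m (k m)).unpair.1 (Nat.pair m (k m)).unpair.2
        (restr (Nat.pair m (k m)).unpair.1 z) = k m := by
      rw [Nat.unpair_pair]
      exact if_pos hm
    dsimp only
    rw [this]
    exact hkU m

/-- The representation of a quotient of a subspace of Baire space by the names of its points. -/
noncomputable def nameRep (hρ : IsQuotientMap ρ) [T0Space Y] : Representation Y where
  dom := {p | ∃ y, b.IsName ρ p y}
  toFun p := p.2.choose
  surjective y := by
    obtain ⟨g, -, hg⟩ := b.exists_continuous_isName hρ Set.univ (fun _ => y) continuous_const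
    have h := hg ⟨0, trivial⟩
    exact ⟨⟨_, y, h⟩, IsName.unique b (Exists.choose_spec (p := b.IsName ρ _) ⟨y, h⟩) h⟩

theorem nameRep_eq_iff [T0Space Y] (hρ : IsQuotientMap ρ) (p : (b.nameRep hρ).dom) {y : Y} :
    (b.nameRep hρ).toFun p = y ↔ b.IsName ρ p y := by
  have h : b.IsName ρ p ((b.nameRep hρ).toFun p) := p.2.choose_spec
  exact ⟨fun e => e ▸ h, fun h' => h.unique b h'⟩

/-- Continuity holds because one entry of a name already certifies membership in an open set; the
factorization is a continuous choice of names. -/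
theorem admissible_nameRep [T0Space Y] (hρ : IsQuotientMap ρ) : (b.nameRep hρ).Admissible := by
  constructor
  · rw [continuous_def]
    intro U hU
    rw [isOpen_iff_mem_nhds]
    intro p hp
    have hn := (b.nameRep_eq_iff hρ p).mp rfl
    obtain ⟨i, hi⟩ := hn.2 U hU hp
    have hcont : Continuous fun q : (b.nameRep hρ).dom => q.1 i :=
      (continuous_apply i).comp continuous_subtype_val
    filter_upwards [((isOpen_discrete {p.1 i}).preimage hcont).mem_nhds rfl] with q hq
    have hq' : q.1 i = p.1 i := hq
    apply hi
    rw [← hq']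
    exact ((b.nameRep_eq_iff hρ q).mp rfl).1 i
  · intro Z ν hν
    obtain ⟨g, hg, h⟩ := b.exists_continuous_isName hρ Z ν hν
    exact ⟨fun z => ⟨g z, _, h z⟩, hg.subtype_mk _,
      funext fun z => ((b.nameRep_eq_iff hρ ⟨g z, _, h z⟩).mpr (h z)).symm⟩

theorem mem_EQ_nameRep [T0Space Y] (hρ : IsQuotientMap ρ) (z : Baire × Baire) :
    z ∈ (b.nameRep hρ).EQ ↔ ∃ x : D, b.IsName ρ z.1 (ρ x) ∧ b.IsName ρ z.2 (ρ x) := by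
  constructor
  · rintro ⟨hp, hq, h⟩
    obtain ⟨x, hx⟩ := hρ.surjective ((b.nameRep hρ).toFun ⟨z.2, hq⟩)
    exact ⟨x, (b.nameRep_eq_iff hρ _).mp (h.trans hx.symm), (b.nameRep_eq_iff hρ _).mp hx.symm⟩
  · rintro ⟨x, hp, hq⟩
    exact ⟨⟨_, hp⟩, ⟨_, hq⟩, ((b.nameRep_eq_iff hρ _).mpr hp).trans
      ((b.nameRep_eq_iff hρ _).mpr hq).symm⟩

theorem specializes_iff_codesOpen (hρ : Continuous ρ) (x x' : D) :
    ρ x ⤳ ρ x' ↔ ∀ c, b.CodesOpen ρ c → x'.1 ∈ b.opn c → x.1 ∈ b.opn c := by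
  rw [specializes_iff_forall_open]
  constructor
  · rintro h c ⟨V, hV, hc⟩ hx
    exact (hc x).mp (h V hV ((hc x').mpr hx))
  · intro h V hV hx
    obtain ⟨c, hc⟩ := b.exists_opn_eq hρ hV
    exact (hc x).mpr (h c ⟨V, hV, hc⟩ ((hc x').mp hx))

/-- Quantifiers over open sets of `Y` turn into quantifiers over codes, so that only `D`, the basic
sets and `CodesOpen` remain. -/
theorem isName_iff_codesOpen (hρ : Continuous ρ) (p : Baire) (x : D) :
    b.IsName ρ p (ρ x) ↔
      (∀ i, ∃ n, n ∈ Denumerable.ofNat (List ℕ) (p i) ∧ ∃ x', x' ∈ D ∧ x' ∈ b.basic n ∧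
        ∀ c, b.CodesOpen ρ c → x' ∈ b.opn c → x.1 ∈ b.opn c) ∧
      ∀ c, b.CodesOpen ρ c → x.1 ∈ b.opn c → ∃ i, ∀ n, n ∈ Denumerable.ofNat (List ℕ) (p i) →
        ∀ x', x' ∈ D → x' ∈ b.basic n → x' ∈ b.opn c := by
  have hsub : ∀ {V : Set Y} {c : Baire} (_ : IsOpen V) (_ : ∀ x : D, ρ x ∈ V ↔ x.1 ∈ b.opn c)
      (k : ℕ), b.satBasic ρ k ⊆ V ↔ ∀ n, n ∈ Denumerable.ofNat (List ℕ) k →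
        ∀ x', x' ∈ D → x' ∈ b.basic n → x' ∈ b.opn c := by
    intro V c hV hc k
    rw [b.satBasic_subset_iff hV]
    exact ⟨fun h n hn x' hx' hb => (hc ⟨x', hx'⟩).mp (h n hn ⟨x', hx'⟩ hb),
      fun h n hn x' hb => (hc x').mpr (h n hn x' x'.2 hb)⟩
  refine and_congr (forall_congr' fun i => exists_congr fun n => and_congr_right fun _ => ?_) ?_
  · constructor
    · rintro ⟨x', hb, hs⟩
      exact ⟨x', x'.2, hb, (b.specializes_iff_codesOpen hρ _ _).mp hs⟩
    · rintro ⟨x', hx', hb, hs⟩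
      exact ⟨⟨x', hx'⟩, hb, (b.specializes_iff_codesOpen hρ _ _).mpr hs⟩
  · constructor
    · rintro h c ⟨V, hV, hc⟩ hx
      obtain ⟨i, hi⟩ := h V hV ((hc x).mpr hx)
      exact ⟨i, (hsub hV hc _).mp hi⟩
    · intro h V hV hx
      obtain ⟨c, hc⟩ := b.exists_opn_eq hρ hV
      obtain ⟨i, hi⟩ := h c ⟨V, hV, hc⟩ ((hc x).mp hx)
      exact ⟨i, (hsub hV hc _).mpr hi⟩

/-! ### Complexity of the naming relation -/

section Definability

variable {l : Ordinal.{0}}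

theorem definable_isName (hl : Order.IsSuccLimit l) (hρ : Continuous ρ) (hD : Definable l (· ∈ D))
    (hC : Definable l (b.CodesOpen ρ)) :
    Definable l fun z : Baire × Baire => ∃ h : z.2 ∈ D, b.IsName ρ z.1 (ρ ⟨z.2, h⟩) := by
  have hopn : Definable l fun z : Baire × Baire => z.2 ∈ b.opn z.1 := .of_isOpen hl b.isOpen_mem_opn
  have hbas : Definable l fun z : ℕ × Baire => z.2 ∈ b.basic z.1 :=
    .of_isOpen hl b.isOpen_mem_basic
  have hlist : Definable l fun z : ℕ × ℕ => z.1 ∈ Denumerable.ofNat (List ℕ) z.2 :=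
    .of_isOpen hl (isOpen_discrete _)
  have happ : Continuous fun z : ℕ × Baire => z.2 z.1 := by
    rw [continuous_prod_of_discrete_left]
    intro n
    fun_prop
  -- For points of `D` this says that `ρ z.2` specializes to `ρ z.1`.
  have h1 : Definable l fun z : Baire × Baire => ∀ c, b.CodesOpen ρ c → z.1 ∈ b.opn c →
      z.2 ∈ b.opn c := by
    apply Definable.forall_baire hl
    apply Definable.imp hl (hC.comp continuous_fst)
    exact Definable.imp hl
      (hopn.comp (f := fun z : Baire × Baire × Baire => (z.1, z.2.1)) (by fun_prop))
      (hopn.comp (f := fun z : Baire × Baire × Baire => (z.1, z.2.2)) (by fun_prop))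
  have h2 : Definable l fun z : ℕ × Baire × Baire =>
      ∃ n, n ∈ Denumerable.ofNat (List ℕ) (z.2.1 z.1) ∧ ∃ x', x' ∈ D ∧ x' ∈ b.basic n ∧
        ∀ c, b.CodesOpen ρ c → x' ∈ b.opn c → z.2.2 ∈ b.opn c := by
    apply Definable.exists_nat hl
    refine (hlist.comp (f := fun z : ℕ × ℕ × Baire × Baire => (z.1, z.2.2.1 z.2.1)) ?_).and ?_
    · exact continuous_fst.prodMk (happ.comp
        (by fun_prop : Continuous fun z : ℕ × ℕ × Baire × Baire => (z.2.1, z.2.2.1)))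
    apply Definable.exists_baire hl
    refine (hD.comp continuous_fst).and ((hbas.comp
      (f := fun z : Baire × ℕ × ℕ × Baire × Baire => (z.2.1, z.1)) (by fun_prop)).and ?_)
    exact h1.comp (f := fun z : Baire × ℕ × ℕ × Baire × Baire => (z.1, z.2.2.2.2)) (by fun_prop)
  have h3 : Definable l fun z : ℕ × Baire => ∀ x', x' ∈ D → x' ∈ b.basic z.1 → x' ∈ b.opn z.2 := by
    apply Definable.forall_baire hl
    exact (hD.comp continuous_fst).imp hl ((hbas.comp
      (f := fun z : Baire × ℕ × Baire => (z.2.1, z.1)) (by fun_prop)).imp hl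
      (hopn.comp (f := fun z : Baire × ℕ × Baire => (z.2.2, z.1)) (by fun_prop)))
  have h4 : Definable l fun z : Baire × Baire => ∃ i, ∀ n,
      n ∈ Denumerable.ofNat (List ℕ) (z.1 i) →
        ∀ x', x' ∈ D → x' ∈ b.basic n → x' ∈ b.opn z.2 := by
    apply Definable.exists_nat hl
    apply Definable.forall_nat hl
    refine (hlist.comp (f := fun z : ℕ × ℕ × Baire × Baire => (z.1, z.2.2.1 z.2.1)) ?_).imp hl ?_
    · exact continuous_fst.prodMk (happ.comp
        (by fun_prop : Continuous fun z : ℕ × ℕ × Baire × Baire => (z.2.1, z.2.2.1)))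
    · exact h3.comp (f := fun z : ℕ × ℕ × Baire × Baire => (z.1, z.2.2.2)) (by fun_prop)
  have h5 : Definable l fun z : Baire × Baire => ∀ c, b.CodesOpen ρ c → z.2 ∈ b.opn c →
      ∃ i, ∀ n, n ∈ Denumerable.ofNat (List ℕ) (z.1 i) →
        ∀ x', x' ∈ D → x' ∈ b.basic n → x' ∈ b.opn c := by
    apply Definable.forall_baire hl
    exact (hC.comp continuous_fst).imp hl ((hopn.comp
      (f := fun z : Baire × Baire × Baire => (z.1, z.2.2)) (by fun_prop)).imp hl
      (h4.comp (f := fun z : Baire × Baire × Baire => (z.2.1, z.1)) (by fun_prop)))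
  refine ((hD.comp continuous_snd).and ((Definable.forall_nat hl
    (P := fun (z : Baire × Baire) i => ∃ n, n ∈ Denumerable.ofNat (List ℕ) (z.1 i) ∧
      ∃ x', x' ∈ D ∧ x' ∈ b.basic n ∧ ∀ c, b.CodesOpen ρ c → x' ∈ b.opn c → z.2 ∈ b.opn c)
    h2).and h5)).congr fun z => ?_
  rw [← exists_prop]
  exact exists_congr fun h => b.isName_iff_codesOpen hρ z.1 ⟨z.2, h⟩

theorem definable_EQ_nameRep [T0Space Y] (hl : Order.IsSuccLimit l)
    (hρ : IsQuotientMap ρ) (hD : Definable l (· ∈ D))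
    (hC : Definable l (b.CodesOpen ρ)) :
    (b.nameRep hρ).EQ ∈ (sigmaOneLT l).sets (Baire × Baire) := by
  have hN := b.definable_isName hl hρ.continuous hD hC
  refine (Definable.exists_baire hl
    (P := fun z x => (∃ h : x ∈ D, b.IsName ρ z.1 (ρ ⟨x, h⟩)) ∧
      ∃ h : x ∈ D, b.IsName ρ z.2 (ρ ⟨x, h⟩))
    ((hN.comp (f := fun z : Baire × Baire × Baire => (z.2.1, z.1)) (by fun_prop)).and
      (hN.comp (f := fun z : Baire × Baire × Baire => (z.2.2, z.1)) (by fun_prop)))).congr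
    fun z => (b.mem_EQ_nameRep hρ z).trans ?_
  constructor
  · rintro ⟨x, h, h'⟩
    exact ⟨x.1, ⟨x.2, h⟩, x.2, h'⟩
  · rintro ⟨x, ⟨hx, h⟩, _, h'⟩
    exact ⟨⟨x, hx⟩, h, h'⟩

end Definability

end OpenEnumeration

/-! ### Admissible representations are quotient maps -/

/-- The function on Baire space sending `0^n k ...` with `k ≠ 0` to `x n`, and `0^ω` to `z`. -/
noncomputable def limitFun {Z : Type*} (x : ℕ → Z) (z : Z) (p : Baire) : Z :=
  open scoped Classical in if h : ∃ n, p n ≠ 0 then x (Nat.find h) else z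

theorem limitFun_single {Z : Type*} (x : ℕ → Z) (z : Z) (n : ℕ) :
    limitFun x z (Pi.single n 1) = x n := by
  classical
  have h : ∃ i, (Pi.single n 1 : Baire) i ≠ 0 := ⟨n, by simp⟩
  have hn : Nat.find h = n := by
    rw [Nat.find_eq_iff]
    exact ⟨by simp, fun i hi => by simp [hi.ne]⟩
  rw [limitFun, dif_pos h]
  exact congrArg x (by convert hn)

theorem limitFun_zero {Z : Type*} (x : ℕ → Z) (z : Z) : limitFun x z 0 = z := by
  simp [limitFun]

/-- The function is locally constant away from `0`, and a small neighbourhood of `0` is sent to a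
tail of the sequence and its limit. -/
theorem continuous_limitFun {Z : Type*} [TopologicalSpace Z] {x : ℕ → Z} {z : Z}
    (h : Tendsto x atTop (𝓝 z)) : Continuous (limitFun x z) := by
  classical
  rw [continuous_iff_continuousAt]
  intro p
  by_cases hp : ∃ n, p n ≠ 0
  · refine (continuousAt_const (y := x (Nat.find hp))).congr ?_
    filter_upwards [eventually_agree p (Nat.find hp + 1)] with q hq
    have hq' : ∃ n, q n ≠ 0 := ⟨Nat.find hp, by
      rw [hq _ (Nat.lt_succ_self _)]; exact Nat.find_spec hp⟩
    have : Nat.find hq' = Nat.find hp := by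
      rw [Nat.find_eq_iff]
      refine ⟨by rw [hq _ (Nat.lt_succ_self _)]; exact Nat.find_spec hp, fun n hn => ?_⟩
      rw [hq n (by omega)]
      exact Nat.find_min hp hn
    rw [limitFun, dif_pos hq']
    exact congrArg x (by convert this.symm)
  · have hp0 : limitFun x z p = z := by rw [limitFun, dif_neg hp]
    rw [ContinuousAt, hp0, tendsto_def]
    intro U hU
    obtain ⟨N, hN⟩ := eventually_atTop.mp (h.eventually hU)
    filter_upwards [eventually_agree p N] with q hq
    rw [Set.mem_preimage, limitFun]
    split_ifs with h'
    · apply hN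
      by_contra! hlt
      push Not at hp
      have := Nat.find_spec h'
      rw [hq _ (by convert hlt), hp] at this
      exact this rfl
    · exact mem_of_mem_nhds hU

theorem tendsto_single : Tendsto (fun n => (Pi.single n 1 : Baire)) atTop (𝓝 0) := by
  rw [tendsto_pi_nhds]
  intro i
  refine tendsto_nhds_of_eventually_eq ?_
  filter_upwards [eventually_gt_atTop i] with n hn
  simp [hn.ne]

/-- An admissible representation of a quotient of a first countable space is a quotient map. -/
theorem Representation.Admissible.isQuotientMap {X : Type u} [TopologicalSpace X]
    {δ : Representation X} (hδ : δ.Admissible) {Z : Type*} [TopologicalSpace Z]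
    [FirstCountableTopology Z] {π : Z → X} (hπ : IsQuotientMap π) : IsQuotientMap δ.toFun := by
  rw [isQuotientMap_iff, isCoinducing_iff]
  refine ⟨fun S => ⟨fun hS => ?_, fun hS => hS.preimage hδ.1⟩, δ.surjective⟩
  rw [← hπ.isOpen_preimage, ← isClosed_compl_iff]
  -- First countability reduces openness to sequences. A convergent sequence extends to a continuous
  -- function on Baire space, which factors through `δ`, so the preimage of `S` is open and contains
  -- some `Pi.single n 1` once it contains `0`.
  refine IsSeqClosed.isClosed fun x z hx hxz hz => ?_
  let ν : ↥(Set.univ : Set Baire) → X := fun p => π (limitFun x z p)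
  have hν : Continuous ν :=
    hπ.continuous.comp ((continuous_limitFun hxz).comp continuous_subtype_val)
  obtain ⟨g, hg, hgν⟩ := hδ.2 _ ν hν
  have hopen : IsOpen (ν ⁻¹' S) := by
    rw [hgν]
    exact hS.preimage hg
  have hlim : Tendsto (fun n => (⟨Pi.single n 1, trivial⟩ : (Set.univ : Set Baire))) atTop
      (𝓝 ⟨0, trivial⟩) := tendsto_subtype_rng.mpr tendsto_single
  have h0 : (⟨0, trivial⟩ : (Set.univ : Set Baire)) ∈ ν ⁻¹' S := by
    simpa [ν, limitFun_zero] using hz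
  obtain ⟨n, hn⟩ := (hlim.eventually (hopen.mem_nhds h0)).exists
  apply hx n
  simpa [ν, limitFun_single] using hn

/-! ### Complexity of the coequalizer -/

theorem definable_graph {l : Ordinal.{0}} (hl : Order.IsSuccLimit l) {D : Set Baire}
    (hD : Definable l (· ∈ D)) {F : D → Baire} (hF : Continuous F) :
    Definable l fun z : Baire × Baire => ∃ h : z.1 ∈ D, F ⟨z.1, h⟩ = z.2 := by
  -- `F` is continuous only on `D`, so its values are read off from open sets of the whole Baire
  -- space.
  have hO : ∀ n k, ∃ O : Set Baire, IsOpen O ∧ ∀ x : D, x.1 ∈ O ↔ F x n = k := by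
    intro n k
    have hc : Continuous fun x : D => F x n := (continuous_apply n).comp hF
    obtain ⟨O, hO, h⟩ := isOpen_induced_iff.mp ((isOpen_discrete {k}).preimage hc)
    exact ⟨O, hO, fun x => Set.ext_iff.mp h x⟩
  choose O hO hmem using hO
  have hopen : Definable l fun z : ℕ × Baire × Baire => z.2.1 ∈ O z.1 (z.2.2 z.1) := by
    refine .of_isOpen hl ?_
    have : {z : ℕ × Baire × Baire | z.2.1 ∈ O z.1 (z.2.2 z.1)} =
        ⋃ n, Prod.fst ⁻¹' {n} ∩ {z | z.2.1 ∈ O n (z.2.2 n)} := by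
      ext z; simp
    rw [this]
    exact isOpen_iUnion fun n => ((isOpen_discrete _).preimage continuous_fst).inter
      (isOpen_setOf_prod_nat (by fun_prop) (by fun_prop) (hO n))
  refine ((hD.comp continuous_fst).and (Definable.forall_nat hl
    (P := fun (z : Baire × Baire) n => z.1 ∈ O n (z.2 n)) hopen)).congr fun z => ?_
  rw [← exists_prop]
  exact exists_congr fun h => ⟨fun e n => (hmem _ _ ⟨z.1, h⟩).mpr (congrFun e n),
    fun e => funext fun n => (hmem _ _ ⟨z.1, h⟩).mp (e n)⟩

theorem Representation.definable_dom {l : Ordinal.{0}} {X : Type u} {δ : Representation X}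
    (h : δ.EQ ∈ (sigmaOneLT l).sets (Baire × Baire)) : Definable l (· ∈ δ.dom) :=
  (Definable.comp (P := (· ∈ δ.EQ)) h (f := fun x : Baire => (x, x)) (by fun_prop)).congr
    fun _ => ⟨fun hx => ⟨hx, hx, rfl⟩, fun hx => hx.1⟩

/-- A quotient map onto a `T₀` space `Y` whose topology consists of the images of the open sets
that `f` and `g` do not distinguish. -/
structure IsT0Coequalizer {A X Y : Type*} [TopologicalSpace X] [TopologicalSpace Y]
    (f g : A → X) (q : X → Y) : Prop where
  isQuotientMap : IsQuotientMap q
  comp_eq : ∀ a, q (f a) = q (g a)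
  exists_open : ∀ U : Set X, IsOpen U → (∀ a, f a ∈ U ↔ g a ∈ U) →
    ∃ V : Set Y, IsOpen V ∧ q ⁻¹' V = U

/-- The first clause makes the coded set the preimage of a subset of `X`, open since `δX` is a
quotient map. The second, stated on names through the realizers `F` and `G`, says that `f` and `g`
do not distinguish that subset, so it descends to `Y`. -/
theorem IsT0Coequalizer.codesOpen_iff {A X Y : Type*} [TopologicalSpace X]
    [TopologicalSpace Y] {f g : A → X} {q : X → Y} (hq : IsT0Coequalizer f g q)
    {δA : Representation A} {δX : Representation X} (hδX : IsQuotientMap δX.toFun)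
    {F G : δA.dom → δX.dom} (hF : f ∘ δA.toFun = δX.toFun ∘ F)
    (hG : g ∘ δA.toFun = δX.toFun ∘ G) (b : OpenEnumeration) (c : Baire) :
    b.CodesOpen (q ∘ δX.toFun) c ↔
      (∀ x x', (x, x') ∈ δX.EQ → x ∈ b.opn c → x' ∈ b.opn c) ∧
      ∀ a x x', (∃ h : a ∈ δA.dom, (F ⟨a, h⟩).1 = x) → (∃ h : a ∈ δA.dom, (G ⟨a, h⟩).1 = x') →
        ((x ∈ b.opn c → x' ∈ b.opn c) ∧ (x' ∈ b.opn c → x ∈ b.opn c)) := by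
  have hF' : ∀ a, f (δA.toFun a) = δX.toFun (F a) := congrFun hF
  have hG' : ∀ a, g (δA.toFun a) = δX.toFun (G a) := congrFun hG
  constructor
  · rintro ⟨V, hV, hc⟩
    refine ⟨fun x x' ⟨hx, hx', e⟩ h => ?_, ?_⟩
    · have := (hc ⟨x, hx⟩).mpr h
      rw [Function.comp_apply, e] at this
      exact (hc ⟨x', hx'⟩).mp this
    · rintro a _ _ ⟨h, rfl⟩ ⟨_, rfl⟩
      have e : q (δX.toFun (F ⟨a, h⟩)) = q (δX.toFun (G ⟨a, h⟩)) := by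
        rw [← hF', ← hG', hq.comp_eq]
      rw [← hc, ← hc, Function.comp_apply, Function.comp_apply, e]
      exact ⟨id, id⟩
  · rintro ⟨h1, h2⟩
    let U : Set X := {y | ∃ x : δX.dom, x.1 ∈ b.opn c ∧ δX.toFun x = y}
    have hU : ∀ x : δX.dom, δX.toFun x ∈ U ↔ x.1 ∈ b.opn c := fun x =>
      ⟨fun ⟨x', hx', e⟩ => h1 _ _ ⟨x'.2, x.2, e⟩ hx', fun hx => ⟨x, hx, rfl⟩⟩
    have hUo : IsOpen U := by
      rw [← hδX.isOpen_preimage]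
      have : δX.toFun ⁻¹' U = Subtype.val ⁻¹' b.opn c := Set.ext hU
      rw [this]
      exact (b.isOpen_opn c).preimage continuous_subtype_val
    obtain ⟨V, hV, hVU⟩ := hq.exists_open U hUo fun a => by
      obtain ⟨a, rfl⟩ := δA.surjective a
      rw [hF', hG', hU, hU]
      have := h2 a _ _ ⟨a.2, rfl⟩ ⟨a.2, rfl⟩
      exact ⟨this.1, this.2⟩
    exact ⟨V, hV, fun x => by rw [← hU, ← hVU]; rfl⟩

theorem IsT0Coequalizer.exists_admissible {l : Ordinal.{0}} (hl : Order.IsSuccLimit l)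
    {A X Y : Type u} [TopologicalSpace A] [TopologicalSpace X] [TopologicalSpace Y] [T0Space Y]
    {f g : A → X} (hf : Continuous f) (hg : Continuous g) {q : X → Y}
    (hq : IsT0Coequalizer f g q) {δA : Representation A} (hδA : Continuous δA.toFun)
    (hEA : δA.EQ ∈ (sigmaOneLT l).sets (Baire × Baire)) {δX : Representation X}
    (hδX : δX.Admissible) (hδX' : IsQuotientMap δX.toFun)
    (hEX : δX.EQ ∈ (sigmaOneLT l).sets (Baire × Baire)) :
    ∃ δ : Representation Y, δ.Admissible ∧ δ.EQ ∈ (sigmaOneLT l).sets (Baire × Baire) := by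
  obtain ⟨b⟩ := nonempty_openEnumeration
  obtain ⟨F, hF, hfF⟩ := hδX.2 _ _ (hf.comp hδA)
  obtain ⟨G, hG, hgG⟩ := hδX.2 _ _ (hg.comp hδA)
  have hρ : IsQuotientMap (q ∘ δX.toFun) := hq.isQuotientMap.comp hδX'
  refine ⟨b.nameRep hρ, b.admissible_nameRep hρ,
    b.definable_EQ_nameRep hl hρ (Representation.definable_dom hEX) ?_⟩
  have hopn : Definable l fun z : Baire × Baire => z.2 ∈ b.opn z.1 := .of_isOpen hl b.isOpen_mem_opn
  have hDA := Representation.definable_dom hEA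
  have hgrF := definable_graph hl hDA (continuous_subtype_val.comp hF)
  have hgrG := definable_graph hl hDA (continuous_subtype_val.comp hG)
  refine Definable.congr ?_ fun c => hq.codesOpen_iff hδX' hfF hgG b c
  refine Definable.and ?_ ?_
  · refine Definable.forall_baire hl (Definable.forall_baire hl ?_)
    exact (Definable.comp (P := (· ∈ δX.EQ)) hEX
      (f := fun z : Baire × Baire × Baire => (z.2.1, z.1)) (by fun_prop)).imp hl
      ((hopn.comp (f := fun z : Baire × Baire × Baire => (z.2.2, z.2.1)) (by fun_prop)).imp hl
        (hopn.comp (f := fun z : Baire × Baire × Baire => (z.2.2, z.1)) (by fun_prop)))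
  · refine Definable.forall_baire hl (Definable.forall_baire hl (Definable.forall_baire hl ?_))
    have hx := hopn.comp (f := fun z : Baire × Baire × Baire × Baire => (z.2.2.2, z.2.1))
      (by fun_prop)
    have hx' := hopn.comp (f := fun z : Baire × Baire × Baire × Baire => (z.2.2.2, z.1))
      (by fun_prop)
    exact (hgrF.comp (f := fun z : Baire × Baire × Baire × Baire => (z.2.2.1, z.2.1))
      (by fun_prop)).imp hl ((hgrG.comp
        (f := fun z : Baire × Baire × Baire × Baire => (z.2.2.1, z.1)) (by fun_prop)).imp hl
        ((hx.imp hl hx').and (hx'.imp hl hx)))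

/-! ### Construction of coequalizers -/

section Coequalizer

variable {A X : Type u} [TopologicalSpace X] (f g : A → X)

/-- Two points are related if no open set that `f` and `g` do not distinguish separates them. -/
def coeqSetoid : Setoid X where
  r x y := ∀ U : Set X, IsOpen U → (∀ a, f a ∈ U ↔ g a ∈ U) → (x ∈ U ↔ y ∈ U)
  iseqv := ⟨fun _ _ _ _ => Iff.rfl, fun h U hU h' => (h U hU h').symm,
    fun h k U hU h' => (h U hU h').trans (k U hU h')⟩

theorem isT0Coequalizer_mk :
    IsT0Coequalizer f g (Quotient.mk (coeqSetoid f g)) where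
  isQuotientMap := isQuotientMap_quotient_mk'
  comp_eq a := Quotient.sound fun _ _ h => h a
  exists_open U hU h := by
    have hpre : Quotient.mk (coeqSetoid f g) ⁻¹' (Quotient.mk (coeqSetoid f g) '' U) = U := by
      refine Set.Subset.antisymm ?_ (Set.subset_preimage_image _ _)
      rintro x ⟨y, hy, e⟩
      exact (Quotient.exact e U hU h).mp hy
    refine ⟨_, ?_, hpre⟩
    rw [← (isQuotientMap_quotient_mk' (s := coeqSetoid f g)).isOpen_preimage]
    exact hpre.symm ▸ hU

instance t0Space_coeq : T0Space (Quotient (coeqSetoid f g)) := by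
  rw [t0Space_iff_inseparable]
  rintro ⟨x⟩ ⟨y⟩ h
  refine Quotient.sound fun U hU hfg => ?_
  obtain ⟨V, hV, rfl⟩ := (isT0Coequalizer_mk f g).exists_open U hU hfg
  exact inseparable_iff_forall_isOpen.mp h V hV

theorem IsT0Coequalizer.homeomorph_comp {Y Y' : Type*} [TopologicalSpace Y] [TopologicalSpace Y']
    {f g : A → X} {q : X → Y} (hq : IsT0Coequalizer f g q) (e : Y ≃ₜ Y') :
    IsT0Coequalizer f g (e ∘ q) where
  isQuotientMap := e.isQuotientMap.comp hq.isQuotientMap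
  comp_eq a := congrArg e (hq.comp_eq a)
  exists_open U hU h := by
    obtain ⟨V, hV, rfl⟩ := hq.exists_open U hU h
    exact ⟨e.symm ⁻¹' V, hV.preimage e.symm.continuous, by ext; simp⟩

/-- Preimages under `h` of open sets are not distinguished by `f` and `g`, so `h x` and `h y` are
inseparable. -/
theorem eq_of_coeqSetoid {f g : A → X} {T : Type*} [TopologicalSpace T]
    [T0Space T] {h : X → T} (hc : Continuous h)
    (hfg : ∀ a, h (f a) = h (g a)) {x y : X} (hxy : coeqSetoid f g x y) : h x = h y :=
  (inseparable_iff_forall_isOpen.mpr fun V hV =>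
    hxy (h ⁻¹' V) (hV.preimage hc) fun a => by simp [hfg]).eq

end Coequalizer

section Category

variable {A X : QCB0.{u}} (f g : A ⟶ X)

/-- The coequalizer of two morphisms of qcb₀-spaces. -/
noncomputable def coeqObj : QCB0.{u} :=
  ⟨TopCat.of (Quotient (coeqSetoid f.hom g.hom)), t0Space_coeq f.hom g.hom, by
    obtain ⟨-, Z, _, π, hZ, hπ⟩ := X.property
    exact ⟨Z, _, _, hZ, (isT0Coequalizer_mk f.hom g.hom).isQuotientMap.comp hπ⟩⟩

/-- The coequalizing cofork of two morphisms of qcb₀-spaces. -/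
noncomputable def coeqCofork : Cofork f g :=
  Cofork.ofπ (P := coeqObj f g)
    (ObjectProperty.homMk (TopCat.ofHom ⟨Quotient.mk (coeqSetoid f.hom g.hom),
      (isT0Coequalizer_mk f.hom g.hom).isQuotientMap.continuous⟩)) (by
    ext a
    exact (isT0Coequalizer_mk f.hom g.hom).comp_eq a)

/-- The cofork is a coequalizer. -/
noncomputable def isColimitCoeqCofork : IsColimit (coeqCofork f g) :=
  Cofork.IsColimit.mk' _ fun s => by
    have : T0Space s.pt.obj := s.pt.property.1
    have hs : ∀ a, s.π.hom (f.hom a) = s.π.hom (g.hom a) := fun a =>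
      congrArg (fun k : A ⟶ s.pt => k.hom a) s.condition
    refine ⟨ObjectProperty.homMk (TopCat.ofHom ⟨Quotient.lift s.π.hom fun x y hxy =>
      eq_of_coeqSetoid s.π.hom.hom.continuous hs hxy,
      s.π.hom.hom.continuous.quotient_lift _⟩), ?_, ?_⟩
    · rfl
    · intro m hm
      ext y
      obtain ⟨x, rfl⟩ := Quotient.exists_rep y
      exact congrArg (fun k : X ⟶ s.pt => k.hom x) hm

theorem isT0Coequalizer_of_isColimit (c : Cofork f g) (hc : IsColimit c) :
    IsT0Coequalizer f.hom g.hom c.π.hom := by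
  let e := (isColimitCoeqCofork f g).coconePointUniqueUpToIso hc
  have he : (coeqCofork f g).π ≫ e.hom = c.π :=
    (isColimitCoeqCofork f g).comp_coconePointUniqueUpToIso_hom hc WalkingParallelPair.one
  rw [← he]
  exact (isT0Coequalizer_mk f.hom g.hom).homeomorph_comp
    (TopCat.homeoOfIso ((IsQCB0.{u}).ι.mapIso e))

end Category

end HyperQCB

theorem proposition4p8 (l : Ordinal.{0}) (hlim : Order.IsSuccLimit l)
    (hcount : l < Ordinal.omega 1) :
    HasCoequalizers HyperQCB.QCB0.{u} ∧
      ∀ (A X : HyperQCB.QCB0.{u}) (f g : A ⟶ X),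
        HyperQCB.QCB0Of (HyperQCB.sigmaOneLT l) A →
        HyperQCB.QCB0Of (HyperQCB.sigmaOneLT l) X →
        ∀ c : Cofork f g, IsColimit c →
          HyperQCB.QCB0Of (HyperQCB.sigmaOneLT l) c.pt := by
  constructor
  · have : ∀ {A X : HyperQCB.QCB0.{u}} {f g : A ⟶ X}, HasColimit (parallelPair f g) :=
      fun {_ _ f g} => ⟨⟨_, HyperQCB.isColimitCoeqCofork f g⟩⟩
    exact hasCoequalizers_of_hasColimit_parallelPair _
  · rintro A X f g ⟨δA, hδA, hEA⟩ ⟨δX, hδX, hEX⟩ c hc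
    have : T0Space c.pt.obj := c.pt.property.1
    obtain ⟨-, Z, _, π, _, hπ⟩ := X.property
    exact (HyperQCB.isT0Coequalizer_of_isColimit f g c hc).exists_admissible hlim
      f.hom.hom.continuous g.hom.hom.continuous hδA.1 hEA hδX (hδX.isQuotientMap hπ) hEX
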